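/- Let $\Delta=\{c\in\mathbb C:|c|<1\}$ and let $\overline{\mathbb C}=\mathbb C\cup\{\infty\}$ be the Riemann sphere. A holomorphic motion of a set $E\subset\overline{\mathbb C}$ (parametrized by $\Delta$, with base point $0$) is a map $h:\Delta\times E\to\overline{\mathbb C}$ such that $h(0,z)=z$ for all $z\in E$, such that $z\mapsto h(c,z)$ is injective on $E$ for every $c\in\Delta$, and such that $c\mapsto h(c,z)$ is holomorphic on $\Delta$ for every $z\in E$. It is called normalized if $0,1,\infty\in E$ and $h(c,0)=0$, $h(c,1)=1$, $h(c,\infty)=\infty$ for all $c\in\Delta$. Theorem. For every $R>0$ there is a number $C$, depending only on $R$, with the following property. Let $h$ be a normalized holomorphic motion of a set $E\subset\overline{\mathbb C}$. Then the tangent vector field $$V(z)=\lim_{c\to 0}\frac{h(c,z)-z}{c},\qquad z\in E\cap\mathbb C,$$ to $h$ at $c=0$ is well defined, and for every $\delta$ with $0<\delta<1$ and all $z_1,z_2\in E\cap\mathbb C$ with $|z_1|<R$, $|z_2|<R$ and $|z_1-z_2|<\delta$, $$|V(z_2)-V(z_1)|\le |z_2-z_1|\left(2+\frac{C}{\log\frac1\delta}\right)\log\frac{1}{|z_2-z_1|},$$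 where the right-hand side is read as $0$ if $z_1=z_2$. -/

import Mathlib

open Filter Topology

/-- The Riemann sphere, the one-point compactification of the complex plane. -/
abbrev Sphere : Type := OnePoint ℂ

namespace Sphere

/-- The inversion `z ↦ 1 / z` of the sphere; it exchanges `0` and `∞`. -/
noncomputable def inversion (p : Sphere) : Sphere :=
  p.elim ((0 : ℂ) : Sphere) (fun z => if z = 0 then OnePoint.infty else ((z⁻¹ : ℂ) : Sphere))

/-- The affine coordinate of a finite point of the sphere (the value at `∞` is irrelevant). -/
def coord (p : Sphere) : ℂ := p.elim 0 id

/-- A map from the plane into the sphere is holomorphic at `c₀` if near `c₀` it is given by a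
holomorphic function in one of the two standard charts `z` and `1 / z` of the sphere. -/
def HolomorphicAt (f : ℂ → Sphere) (c₀ : ℂ) : Prop :=
  ∃ g : ℂ → ℂ, AnalyticAt ℂ g c₀ ∧
    ((∀ᶠ c in 𝓝 c₀, f c = (g c : Sphere)) ∨ (∀ᶠ c in 𝓝 c₀, inversion (f c) = (g c : Sphere)))

end Sphere

/-- `h` is a holomorphic motion of `E`, parametrized by the open unit disk and with base point `0`.
Only the values `h c z` with `c` in the unit disk and `z ∈ E` matter. -/
structure IsHolomorphicMotion (E : Set Sphere) (h : ℂ → Sphere → Sphere) : Prop where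
  base : ∀ z ∈ E, h 0 z = z
  injOn : ∀ c ∈ Metric.ball (0 : ℂ) 1, Set.InjOn (h c) E
  holomorphic : ∀ z ∈ E, ∀ c ∈ Metric.ball (0 : ℂ) 1, Sphere.HolomorphicAt (fun c' => h c' z) c

/-- A holomorphic motion is normalized if the points `0`, `1`, `∞` belong to `E` and stay fixed. -/
structure IsNormalizedHolomorphicMotion (E : Set Sphere) (h : ℂ → Sphere → Sphere) : Prop
    extends IsHolomorphicMotion E h where
  zero_mem : ((0 : ℂ) : Sphere) ∈ E
  one_mem : ((1 : ℂ) : Sphere) ∈ E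
  infty_mem : (OnePoint.infty : Sphere) ∈ E
  fix_zero : ∀ c ∈ Metric.ball (0 : ℂ) 1, h c ((0 : ℂ) : Sphere) = ((0 : ℂ) : Sphere)
  fix_one : ∀ c ∈ Metric.ball (0 : ℂ) 1, h c ((1 : ℂ) : Sphere) = ((1 : ℂ) : Sphere)
  fix_infty : ∀ c ∈ Metric.ball (0 : ℂ) 1, h c OnePoint.infty = OnePoint.infty

/-- `V` is the vector field tangent to the motion `h` of `E` at `c = 0`: at every finite point `z`
of `E`, `V z` is the limit of `(h c z - z) / c` as `c → 0`. (For a normalized motion the points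
`h c z` are finite, because `h c` is injective and fixes `∞`.) -/
def IsTangentField (E : Set Sphere) (h : ℂ → Sphere → Sphere) (V : ℂ → ℂ) : Prop :=
  ∀ z : ℂ, (z : Sphere) ∈ E →
    Tendsto (fun c : ℂ => (Sphere.coord (h c (z : Sphere)) - z) / c) (𝓝[≠] 0) (𝓝 (V z))

/-! The coefficient 2 comes from a form of Landau's theorem: if `f` is holomorphic on the unit disk
and omits 0 and 1, then |f'(0)| ≤ |f(0)| (2 |log |f(0)|| + 60) (`norm_deriv_le_of_omits_zero_one`).
For three points of `E`, the ratio f(c) = (h(c,z₂) − h(c,z₁)) / (h(c,w) − h(c,z₁)) is such a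
function, because h(c,·) is injective and fixes ∞. Take w to be whichever of 0, 1 is at distance at
least 1/2 from z₁; then V(w) = 0, and f'(0) is (V(z₂) − V(z₁)) / (w − z₁) up to a term controlled by
V(z₁). The case z₁ = 0, w = 1 bounds V itself. Hence |V(z₂) − V(z₁)| ≤ d (2 log(1/d) + C) with d =
|z₂ − z₁|, and d < δ turns C into a multiple of log(1/d).

Landau's theorem is proved by Ahlfors' method. The metric |dz| / (|z| (|log |z|| + 30)) has
curvature −1 off the unit circle, but on the circle its kink has the wrong sign. There a second,
negatively curved metric is larger, and at |log |z|| = 4 it is smaller again, so the two can be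
glued. A maximum principle for pullbacks (`cuspMetric_zero_mul_le`) compares them with the
hyperbolic metric. -/

/-! ### Second-order jets and Laplacians at a point -/

/-- `φ` is differentiable near `0`, with `φ' 0 = a` and `φ'' 0 = b`. -/
def HasSecondJet (φ : ℝ → ℝ) (a b : ℝ) : Prop :=
  ∃ φ₁ : ℝ → ℝ, (∀ᶠ t in 𝓝 0, HasDerivAt φ (φ₁ t) t) ∧ φ₁ 0 = a ∧ HasDerivAt φ₁ b 0

namespace HasSecondJet

theorem add {φ ψ : ℝ → ℝ} {a b a' b' : ℝ} (h : HasSecondJet φ a b) (h' : HasSecondJet ψ a' b') :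
    HasSecondJet (fun t => φ t + ψ t) (a + a') (b + b') := by
  obtain ⟨φ₁, h1, h2, h3⟩ := h
  obtain ⟨ψ₁, k1, k2, k3⟩ := h'
  refine ⟨fun t => φ₁ t + ψ₁ t, ?_, by simp [h2, k2], h3.add k3⟩
  filter_upwards [h1, k1] with t ht kt using ht.add kt

theorem comp {φ G G₁ : ℝ → ℝ} {a b g : ℝ} (h : HasSecondJet φ a b)
    (hG : ∀ᶠ y in 𝓝 (φ 0), HasDerivAt G (G₁ y) y) (hG₁ : HasDerivAt G₁ g (φ 0)) :
    HasSecondJet (fun t => G (φ t)) (G₁ (φ 0) * a) (g * a ^ 2 + G₁ (φ 0) * b) := by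
  obtain ⟨φ₁, h1, rfl, h3⟩ := h
  have h0 := h1.self_of_nhds
  refine ⟨fun t => G₁ (φ t) * φ₁ t, ?_, rfl, ?_⟩
  · filter_upwards [h1, h0.continuousAt.eventually hG] with t ht kt using kt.comp t ht
  · have := (hG₁.comp (0 : ℝ) h0).mul h3
    exact this.congr_deriv (by simp only [Function.comp_apply]; ring)

theorem congr {φ ψ : ℝ → ℝ} {a b : ℝ} (h : HasSecondJet φ a b) (e : ψ =ᶠ[𝓝 0] φ) :
    HasSecondJet ψ a b := by
  obtain ⟨φ₁, h1, h2, h3⟩ := h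
  refine ⟨φ₁, ?_, h2, h3⟩
  filter_upwards [h1, e.eventuallyEq_nhds] with t ht kt using ht.congr_of_eventuallyEq kt

/-- If `b` were positive, the second derivative test would make 0 a local minimum as well, so `φ`
would be locally constant and `b` would vanish. -/
theorem nonpos_of_isLocalMax {φ : ℝ → ℝ} {a b : ℝ} (h : HasSecondJet φ a b)
    (hm : IsLocalMax φ 0) : b ≤ 0 := by
  obtain ⟨φ₁, h1, rfl, h3⟩ := h
  have h0 := h1.self_of_nhds
  have hz := hm.hasDerivAt_eq_zero h0
  by_contra! hb
  have hd : deriv φ =ᶠ[𝓝 0] φ₁ := by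
    filter_upwards [h1] with t ht using ht.deriv
  have hmin : IsLocalMin φ 0 := by
    apply isLocalMin_of_deriv_deriv_pos
    · rw [hd.deriv_eq, h3.deriv]; exact hb
    · rw [h0.deriv, hz]
    · exact h0.continuousAt
  have hc : φ =ᶠ[𝓝 0] fun _ => φ 0 := by
    filter_upwards [hm, hmin] with t ht kt using le_antisymm ht kt
  have hc1 : φ₁ =ᶠ[𝓝 0] fun _ => 0 := by
    filter_upwards [hc.eventuallyEq_nhds, h1] with t ht kt
    exact kt.unique ((hasDerivAt_const t (φ 0)).congr_of_eventuallyEq ht)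
  exact hb.ne' (h3.unique ((hasDerivAt_const 0 (0 : ℝ)).congr_of_eventuallyEq hc1))

end HasSecondJet

/-- `φ` has the gradient `a` and the Laplacian `l` at `p`, both read off from the second-order
jets of `φ` along the two coordinate lines through `p`. -/
def HasLaplacianAt (φ : ℂ → ℝ) (p a : ℂ) (l : ℝ) : Prop :=
  ∃ b₁ b₂ : ℝ, HasSecondJet (fun t : ℝ => φ (p + t * 1)) a.re b₁ ∧
    HasSecondJet (fun t : ℝ => φ (p + t * Complex.I)) a.im b₂ ∧ b₁ + b₂ = l

theorem tendsto_line (p e : ℂ) : Tendsto (fun t : ℝ => p + t * e) (𝓝 0) (𝓝 p) := by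
  have : Continuous fun t : ℝ => p + t * e := by fun_prop
  simpa using this.tendsto 0

namespace HasLaplacianAt

theorem add {φ ψ : ℂ → ℝ} {p a a' : ℂ} {l l' : ℝ} (h : HasLaplacianAt φ p a l)
    (h' : HasLaplacianAt ψ p a' l') :
    HasLaplacianAt (fun c => φ c + ψ c) p (a + a') (l + l') := by
  obtain ⟨b₁, b₂, h1, h2, rfl⟩ := h
  obtain ⟨b₁', b₂', k1, k2, rfl⟩ := h'
  exact ⟨b₁ + b₁', b₂ + b₂', by simpa using h1.add k1, by simpa using h2.add k2, by ring⟩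

theorem comp {φ : ℂ → ℝ} {G G₁ : ℝ → ℝ} {p a : ℂ} {l g : ℝ} (h : HasLaplacianAt φ p a l)
    (hG : ∀ᶠ y in 𝓝 (φ p), HasDerivAt G (G₁ y) y) (hG₁ : HasDerivAt G₁ g (φ p)) :
    HasLaplacianAt (fun c => G (φ c)) p (G₁ (φ p) * a) (G₁ (φ p) * l + g * ‖a‖ ^ 2) := by
  obtain ⟨b₁, b₂, h1, h2, rfl⟩ := h
  have k1 := h1.comp (G := G) (G₁ := G₁) (g := g) (by simpa using hG) (by simpa using hG₁)
  have k2 := h2.comp (G := G) (G₁ := G₁) (g := g) (by simpa using hG) (by simpa using hG₁)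
  refine ⟨_, _, by simpa using k1, by simpa using k2, ?_⟩
  rw [Complex.sq_norm, Complex.normSq_apply]
  ring

theorem const_mul {φ : ℂ → ℝ} {p a : ℂ} {l : ℝ} (h : HasLaplacianAt φ p a l) (k : ℝ) :
    HasLaplacianAt (fun c => k * φ c) p (k * a) (k * l) := by
  have := h.comp (G := fun y => k * y) (G₁ := fun _ => k) (g := 0)
    (Eventually.of_forall fun y => by simpa using (hasDerivAt_id y).const_mul k)
    (hasDerivAt_const _ _)
  simpa using this

theorem const_add {φ : ℂ → ℝ} {p a : ℂ} {l : ℝ} (h : HasLaplacianAt φ p a l) (k : ℝ) :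
    HasLaplacianAt (fun c => k + φ c) p a l := by
  have := h.comp (G := fun y => k + y) (G₁ := fun _ => 1) (g := 0)
    (Eventually.of_forall fun y => by simpa using (hasDerivAt_id y).const_add k)
    (hasDerivAt_const _ _)
  simpa using this

theorem exp {φ : ℂ → ℝ} {p a : ℂ} {l : ℝ} (h : HasLaplacianAt φ p a l) :
    HasLaplacianAt (fun c => Real.exp (φ c)) p (Real.exp (φ p) * a)
      (Real.exp (φ p) * l + Real.exp (φ p) * ‖a‖ ^ 2) := by
  simpa using h.comp (Eventually.of_forall Real.hasDerivAt_exp) (Real.hasDerivAt_exp _)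

theorem sq {φ : ℂ → ℝ} {p a : ℂ} {l : ℝ} (h : HasLaplacianAt φ p a l) :
    HasLaplacianAt (fun c => φ c ^ 2) p ((2 * φ p : ℝ) * a) (2 * φ p * l + 2 * ‖a‖ ^ 2) :=
  h.comp (G := fun y => y ^ 2) (G₁ := fun y => 2 * y)
    (Eventually.of_forall fun y => by simpa using hasDerivAt_pow 2 y)
    (by simpa using (hasDerivAt_id (φ p)).const_mul 2)

theorem log {φ : ℂ → ℝ} {p a : ℂ} {l : ℝ} (h : HasLaplacianAt φ p a l) (hp : φ p ≠ 0) :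
    HasLaplacianAt (fun c => Real.log (φ c)) p ((φ p)⁻¹ * a)
      ((φ p)⁻¹ * l - ‖a‖ ^ 2 / φ p ^ 2) := by
  have := h.comp (G := Real.log) (G₁ := fun y => y⁻¹)
    ((eventually_ne_nhds hp).mono fun y hy => Real.hasDerivAt_log hy) (hasDerivAt_inv hp)
  convert this using 1
  ring

theorem nonpos_of_isLocalMax {φ : ℂ → ℝ} {p a : ℂ} {l : ℝ} (h : HasLaplacianAt φ p a l)
    (hm : IsLocalMax φ p) : l ≤ 0 := by
  obtain ⟨b₁, b₂, h1, h2, rfl⟩ := h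
  have e1 : IsLocalMax (fun t : ℝ => φ (p + t * 1)) 0 := by
    have := (tendsto_line p 1).eventually hm
    simpa [IsLocalMax, IsMaxFilter] using this
  have e2 : IsLocalMax (fun t : ℝ => φ (p + t * Complex.I)) 0 := by
    have := (tendsto_line p Complex.I).eventually hm
    simpa [IsLocalMax, IsMaxFilter] using this
  linarith [h1.nonpos_of_isLocalMax e1, h2.nonpos_of_isLocalMax e2]

end HasLaplacianAt

/-! ### Real parts and logarithms of holomorphic functions -/

theorem AnalyticAt.hasSecondJet_re {g : ℂ → ℂ} {p : ℂ} (hg : AnalyticAt ℂ g p) (e : ℂ) :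
    HasSecondJet (fun t : ℝ => (g (p + t * e)).re) (deriv g p * e).re
      (deriv (deriv g) p * e * e).re := by
  have key : ∀ (k : ℂ → ℂ) (t : ℝ), DifferentiableAt ℂ k (p + t * e) →
      HasDerivAt (fun t : ℝ => k (p + t * e)) (deriv k (p + t * e) * e) t := by
    intro k t hk
    have h1 : HasDerivAt (fun t : ℝ => p + (t : ℂ) * e) e t := by
      simpa using (((hasDerivAt_id t).ofReal_comp).mul_const e).const_add p
    exact hk.hasDerivAt.comp t h1
  have re : ∀ (k : ℝ → ℂ) (k' : ℂ) (t : ℝ), HasDerivAt k k' t →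
      HasDerivAt (fun t => (k t).re) k'.re t := fun k k' t hk =>
    Complex.reCLM.hasFDerivAt.comp_hasDerivAt t hk
  refine ⟨fun t => (deriv g (p + t * e) * e).re, ?_, by simp, ?_⟩
  · filter_upwards [(tendsto_line p e).eventually hg.eventually_analyticAt] with t ht
    exact re _ _ _ (key g t ht.differentiableAt)
  · have := key (deriv g) 0 (by simpa using hg.deriv.differentiableAt)
    exact re _ _ _ (by simpa using this.mul_const e)

theorem AnalyticAt.hasLaplacianAt_re {g : ℂ → ℂ} {p : ℂ} (hg : AnalyticAt ℂ g p) :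
    HasLaplacianAt (fun c => (g c).re) p ((starRingEnd ℂ) (deriv g p)) 0 := by
  refine ⟨_, _, by simpa using hg.hasSecondJet_re 1, by simpa using hg.hasSecondJet_re Complex.I, ?_⟩
  simp

theorem hasLaplacianAt_sq_sub_norm_sq (r : ℝ) (p : ℂ) :
    HasLaplacianAt (fun c => r ^ 2 - ‖c‖ ^ 2) p (-2 * p) (-4) := by
  have key : ∀ s q : ℝ, HasSecondJet (fun t => s - (q + t) ^ 2) (-2 * q) (-2) := by
    intro s q
    refine ⟨fun t => -2 * (q + t), Eventually.of_forall fun t => ?_, by simp, ?_⟩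
    · have := (((hasDerivAt_id t).const_add q).pow 2).const_sub s
      exact this.congr_deriv (by simp)
    · simpa using ((hasDerivAt_id (0 : ℝ)).const_add q).const_mul (-2)
  refine ⟨-2, -2, ?_, ?_, by norm_num⟩
  · refine HasSecondJet.congr (φ := fun t => (r ^ 2 - p.im ^ 2) - (p.re + t) ^ 2) ?_ ?_
    · simpa using key (r ^ 2 - p.im ^ 2) p.re
    · refine Eventually.of_forall fun t => ?_
      simp only [Complex.sq_norm, Complex.normSq_apply]
      simp; ring
  · refine HasSecondJet.congr (φ := fun t => (r ^ 2 - p.re ^ 2) - (p.im + t) ^ 2) ?_ ?_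
    · simpa using key (r ^ 2 - p.re ^ 2) p.im
    · refine Eventually.of_forall fun t => ?_
      simp only [Complex.sq_norm, Complex.normSq_apply]
      simp; ring

/-- A nonvanishing holomorphic function has a holomorphic logarithm locally. -/
theorem AnalyticAt.exists_log {g : ℂ → ℂ} {p : ℂ} (hg : AnalyticAt ℂ g p) (hp : g p ≠ 0) :
    ∃ l : ℂ → ℂ, AnalyticAt ℂ l p ∧ (∀ᶠ c in 𝓝 p, Real.log ‖g c‖ = (l c).re) ∧
      deriv l p = deriv g p / g p := by
  have h1 : AnalyticAt ℂ (fun c => g c / g p) p := hg.div analyticAt_const hp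
  have hs : g p / g p ∈ Complex.slitPlane := by rw [div_self hp]; exact Complex.one_mem_slitPlane
  refine ⟨fun c => (Real.log ‖g p‖ : ℂ) + Complex.log (g c / g p),
    analyticAt_const.add (h1.clog hs), ?_, ?_⟩
  · filter_upwards [hg.continuousAt.eventually_ne hp] with c hc
    rw [Complex.add_re, Complex.log_re, Complex.ofReal_re, norm_div,
      Real.log_div (by simpa using hc) (by simpa using hp)]
    ring
  · rw [deriv_const_add]
    have := ((hg.differentiableAt.hasDerivAt).div_const (g p)).clog hs
    rw [this.deriv, div_self hp, div_one]

/-! ### Ahlfors' lemma at a local maximum -/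

/-- The local form of Ahlfors' lemma: a conformal metric `exp w |dc|` of curvature at most `-1`
is dominated by the hyperbolic metric at a local maximum of the ratio of the two. -/
theorem HasLaplacianAt.mul_le_two_mul {w u : ℂ → ℝ} {p a : ℂ} {l r : ℝ}
    (h : HasLaplacianAt w p a l) (hu : ∀ᶠ c in 𝓝 p, u c = Real.exp (w c)) (hp : ‖p‖ < r)
    (hm : IsLocalMax (fun c => u c * (r ^ 2 - ‖c‖ ^ 2)) p) (hl : u p ^ 2 ≤ l) :
    u p * (r ^ 2 - ‖p‖ ^ 2) ≤ 2 * r := by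
  have hr : 0 < r := (norm_nonneg p).trans_lt hp
  have hN : 0 < r ^ 2 - ‖p‖ ^ 2 := by nlinarith [norm_nonneg p]
  have hev : ∀ᶠ c in 𝓝 p, 0 < r ^ 2 - ‖c‖ ^ 2 := by
    have : ContinuousAt (fun c : ℂ => r ^ 2 - ‖c‖ ^ 2) p := by fun_prop
    exact this.eventually (lt_mem_nhds hN)
  have hN' := (hasLaplacianAt_sq_sub_norm_sq r p).log hN.ne'
  have hup : 0 < u p := by rw [hu.self_of_nhds]; exact Real.exp_pos _
  have hmax : IsLocalMax (fun c => w c + Real.log (r ^ 2 - ‖c‖ ^ 2)) p := by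
    filter_upwards [hm, hu, hev] with c hc huc hNc
    have e : ∀ c, u c = Real.exp (w c) → 0 < r ^ 2 - ‖c‖ ^ 2 →
        w c + Real.log (r ^ 2 - ‖c‖ ^ 2) = Real.log (u c * (r ^ 2 - ‖c‖ ^ 2)) := by
      intro c h1 h2
      rw [h1, Real.log_mul (Real.exp_pos _).ne' h2.ne', Real.log_exp]
    rw [e c huc hNc, e p hu.self_of_nhds hN]
    refine Real.log_le_log (mul_pos ?_ hNc) hc
    rw [huc]; exact Real.exp_pos _
  -- The Laplacian of log(r² − |c|²) is −4r² / (r² − |c|²)², so the maximum forces u² ≤ 4r² / (r² −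
  -- |p|²)².
  have := (h.add hN').nonpos_of_isLocalMax hmax
  have h2 : ‖-2 * p‖ ^ 2 = 4 * ‖p‖ ^ 2 := by rw [norm_mul]; norm_num; ring
  rw [h2] at this
  have h3 : u p ^ 2 * (r ^ 2 - ‖p‖ ^ 2) ^ 2 ≤ 4 * r ^ 2 := by
    have h4 : u p ^ 2 ≤ (r ^ 2 - ‖p‖ ^ 2)⁻¹ * 4 + 4 * ‖p‖ ^ 2 / (r ^ 2 - ‖p‖ ^ 2) ^ 2 := by
      linarith
    calc u p ^ 2 * (r ^ 2 - ‖p‖ ^ 2) ^ 2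
        ≤ ((r ^ 2 - ‖p‖ ^ 2)⁻¹ * 4 + 4 * ‖p‖ ^ 2 / (r ^ 2 - ‖p‖ ^ 2) ^ 2)
          * (r ^ 2 - ‖p‖ ^ 2) ^ 2 := by gcongr
      _ = 4 * r ^ 2 := by field_simp; ring
  exact abs_le_of_sq_le_sq' (by nlinarith) (by positivity) |>.2

/-! ### The two metrics and their curvature -/

/-- The pullback under `f` of a metric of the punctured sphere which is hyperbolic near the
punctures `0` and `∞`. -/
noncomputable def cuspMetric (f : ℂ → ℂ) (c : ℂ) : ℝ :=
  ‖deriv f c / f c‖ / (|Real.log ‖f c‖| + 30)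

/-- The function `log |sinh (L / 2)|` of `f = exp L`. -/
noncomputable def logSinh (q : ℂ) : ℝ := Real.log ‖1 - q‖ - Real.log ‖q‖ / 2 - Real.log 2

/-- The pullback under `f` of a metric which is negatively curved near the unit circle, with a
singularity at `1`. -/
noncomputable def circleMetric (f : ℂ → ℂ) (c : ℂ) : ℝ :=
  ‖deriv f c / f c‖ / 30 *
    Real.exp (-(logSinh (f c)) / 2 + (Real.exp (logSinh (f c)) + Real.log ‖f c‖ ^ 2) / 100)

theorem cuspMetric_eq_exp_log {f : ℂ → ℂ} {p : ℂ} (h0 : f p ≠ 0) (h' : deriv f p ≠ 0) :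
    cuspMetric f p
      = Real.exp (Real.log ‖deriv f p / f p‖ - Real.log (|Real.log ‖f p‖| + 30)) := by
  rw [Real.exp_sub, Real.exp_log (norm_pos_iff.2 (div_ne_zero h' h0)), Real.exp_log (by positivity)]
  rfl

/-- Write f = exp L locally. Where |f| ≠ 1, |Re L| is harmonic, so the Laplacian of −log(|Re L| +
30) is |L'|² / (|Re L| + 30)²: the curvature is exactly −1. -/
theorem cuspMetric_mul_le {f : ℂ → ℂ} {p : ℂ} {r : ℝ} (hf : AnalyticAt ℂ f p) (h0 : f p ≠ 0)
    (h' : deriv f p ≠ 0) (hx : Real.log ‖f p‖ ≠ 0) (hp : ‖p‖ < r)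
    (hm : IsLocalMax (fun c => cuspMetric f c * (r ^ 2 - ‖c‖ ^ 2)) p) :
    cuspMetric f p * (r ^ 2 - ‖p‖ ^ 2) ≤ 2 * r := by
  obtain ⟨L, hL, hLe, hL'⟩ := hf.exists_log h0
  obtain ⟨M, hM, hMe, -⟩ := (hf.deriv.div hf h0).exists_log (div_ne_zero h' h0)
  have hLp := hLe.self_of_nhds
  obtain ⟨σ, hσ, hσ1⟩ : ∃ σ : ℝ, (∀ᶠ c in 𝓝 p, |(L c).re| = σ * (L c).re) ∧ σ ^ 2 = 1 := by
    have hc : ContinuousAt (fun c => (L c).re) p := Complex.continuous_re.continuousAt.comp hL.continuousAt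
    rcases lt_or_gt_of_ne (hLp ▸ hx) with h | h
    · refine ⟨-1, ?_, by norm_num⟩
      filter_upwards [hc.eventually (gt_mem_nhds h)] with c h3
      rw [abs_of_neg h3]; ring
    · refine ⟨1, ?_, by norm_num⟩
      filter_upwards [hc.eventually (lt_mem_nhds h)] with c h3
      rw [abs_of_pos h3]; ring
  have hX : 0 < 30 + σ * (L p).re := by rw [← hσ.self_of_nhds]; positivity
  have J := hM.hasLaplacianAt_re.add
    ((((hL.hasLaplacianAt_re.const_mul σ).const_add 30).log hX.ne').const_mul (-1))
  refine J.mul_le_two_mul ?_ hp hm ?_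
  · filter_upwards [hLe, hMe, hσ, hf.continuousAt.eventually_ne h0,
      hf.deriv.continuousAt.eventually_ne h'] with c h1 h2 h3 h4 h5
    rw [cuspMetric_eq_exp_log h4 h5, ← h2, h1, h3, Pi.div_apply]
    ring_nf
  · have e : ‖(σ : ℂ) * (starRingEnd ℂ) (deriv L p)‖ ^ 2 = ‖deriv f p / f p‖ ^ 2 := by
      rw [norm_mul, mul_pow, RCLike.norm_conj, hL', Complex.norm_real, Real.norm_eq_abs, sq_abs,
        hσ1, one_mul]
    rw [e, cuspMetric, div_pow, hLp, hσ.self_of_nhds]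
    apply le_of_eq
    ring

theorem exp_logSinh {q : ℂ} (h1 : q ≠ 1) :
    Real.exp (logSinh q) = ‖1 - q‖ * Real.exp (-(Real.log ‖q‖ / 2)) / 2 := by
  have : ‖1 - q‖ ≠ 0 := by simpa [sub_eq_zero] using h1.symm
  rw [logSinh, Real.exp_sub, Real.exp_sub, Real.exp_log (by positivity),
    Real.exp_log (by norm_num), Real.exp_neg]
  rfl

theorem norm_eq_exp_half_sq {q : ℂ} (h0 : q ≠ 0) :
    ‖q‖ = Real.exp (Real.log ‖q‖ / 2) * Real.exp (Real.log ‖q‖ / 2) := by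
  rw [← Real.exp_add, add_halves, Real.exp_log (by simpa using h0)]

/-- For q = exp L and x = Re L, |sinh(L/2)| lies between |sinh(x/2)| and cosh(x/2). This is the
upper bound; `le_exp_logSinh` is the lower one. -/
theorem exp_logSinh_le {q : ℂ} (h0 : q ≠ 0) (h1 : q ≠ 1) :
    Real.exp (logSinh q) ≤
      (Real.exp (-(Real.log ‖q‖ / 2)) + Real.exp (Real.log ‖q‖ / 2)) / 2 := by
  rw [exp_logSinh h1]
  have h2 : ‖1 - q‖ ≤ 1 + ‖q‖ := by simpa using norm_sub_le 1 q
  rw [norm_eq_exp_half_sq h0] at h2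
  have h3 : Real.exp (Real.log ‖q‖ / 2) * Real.exp (-(Real.log ‖q‖ / 2)) = 1 := by
    rw [← Real.exp_add]; simp
  have := mul_le_mul_of_nonneg_right h2 (Real.exp_pos (-(Real.log ‖q‖ / 2))).le
  have h4 : Real.exp (Real.log ‖q‖ / 2) * Real.exp (Real.log ‖q‖ / 2)
    * Real.exp (-(Real.log ‖q‖ / 2)) = Real.exp (Real.log ‖q‖ / 2) := by rw [mul_assoc, h3, mul_one]
  linarith

theorem le_exp_logSinh {q : ℂ} (h0 : q ≠ 0) (h1 : q ≠ 1) :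
    |Real.exp (Real.log ‖q‖ / 2) - Real.exp (-(Real.log ‖q‖ / 2))| / 2
      ≤ Real.exp (logSinh q) := by
  rw [exp_logSinh h1]
  have h2 : |‖q‖ - 1| ≤ ‖1 - q‖ := by
    rw [norm_sub_rev]; simpa using abs_norm_sub_norm_le q 1
  have h3 : Real.exp (Real.log ‖q‖ / 2) * Real.exp (-(Real.log ‖q‖ / 2)) = 1 := by
    rw [← Real.exp_add]; simp
  have h4 : Real.exp (Real.log ‖q‖ / 2) - Real.exp (-(Real.log ‖q‖ / 2))
      = (‖q‖ - 1) * Real.exp (-(Real.log ‖q‖ / 2)) := by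
    have h5 := norm_eq_exp_half_sq h0
    linear_combination (-Real.exp (-(Real.log ‖q‖ / 2))) * h5 - Real.exp (Real.log ‖q‖ / 2) * h3
  rw [h4, abs_mul, abs_of_pos (Real.exp_pos _)]
  gcongr

theorem exp_two_lt : Real.exp 2 < 7.4 := by
  have h := Real.exp_one_lt_d9
  have e : Real.exp 2 = Real.exp 1 * Real.exp 1 := by rw [← Real.exp_add]; norm_num
  rw [e]; nlinarith [Real.exp_pos 1]

theorem exp_logSinh_le_of_abs_le {q : ℂ} (h0 : q ≠ 0) (h1 : q ≠ 1) (hx : |Real.log ‖q‖| ≤ 4) :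
    Real.exp (logSinh q) ≤ 7.5 := by
  have := exp_logSinh_le h0 h1
  rw [abs_le] at hx
  have h2 : Real.exp (-(Real.log ‖q‖ / 2)) ≤ Real.exp 2 := Real.exp_le_exp.2 (by linarith)
  have h3 : Real.exp (Real.log ‖q‖ / 2) ≤ Real.exp 2 := Real.exp_le_exp.2 (by linarith)
  linarith [exp_two_lt]

theorem one_le_logSinh {q : ℂ} (h0 : q ≠ 0) (h1 : q ≠ 1) (hx : |Real.log ‖q‖| = 4) :
    1 ≤ logSinh q := by
  have h := le_exp_logSinh h0 h1
  have h2 : |Real.exp (Real.log ‖q‖ / 2) - Real.exp (-(Real.log ‖q‖ / 2))|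
      = Real.exp 2 - Real.exp (-2) := by
    have h3 : (0 : ℝ) ≤ Real.exp 2 - Real.exp (-2) := by
      rw [sub_nonneg]; exact Real.exp_le_exp.2 (by norm_num)
    rcases (abs_eq (by norm_num)).1 hx with e | e <;> rw [e]
    · norm_num
    · rw [abs_sub_comm]; norm_num
  rw [h2] at h
  have e1 : Real.exp 2 = Real.exp 1 * Real.exp 1 := by rw [← Real.exp_add]; norm_num
  have e2 : Real.exp (-2) ≤ 1 := Real.exp_le_one_iff.2 (by norm_num)
  have := Real.exp_one_gt_d9
  rw [← Real.exp_le_exp]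
  nlinarith

/-- On |log |f|| = 4 the exponent in `circleMetric` is at most −1/2 + (7.5 + 16)/100 < −0.2, and
exp(−0.2) < 30/34. -/
theorem circleMetric_lt_cuspMetric {f : ℂ → ℂ} {p : ℂ} (h0 : f p ≠ 0) (h1 : f p ≠ 1)
    (h' : deriv f p ≠ 0) (hx : |Real.log ‖f p‖| = 4) : circleMetric f p < cuspMetric f p := by
  have hs := exp_logSinh_le_of_abs_le h0 h1 hx.le
  have hy := one_le_logSinh h0 h1 hx
  have hpos : 0 < ‖deriv f p / f p‖ := norm_pos_iff.2 (div_ne_zero h' h0)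
  have hx2 : Real.log ‖f p‖ ^ 2 = 16 := by rw [← sq_abs, hx]; norm_num
  have he : Real.exp (-(logSinh (f p)) / 2
      + (Real.exp (logSinh (f p)) + Real.log ‖f p‖ ^ 2) / 100) ≤ Real.exp (-0.2) :=
    Real.exp_le_exp.2 (by rw [hx2]; linarith)
  have he2 : Real.exp (-0.2) < 30 / 34 := by
    have h3 : (1.2 : ℝ) ≤ Real.exp 0.2 := by linarith [Real.add_one_le_exp (0.2 : ℝ)]
    rw [Real.exp_neg, inv_lt_comm₀ (Real.exp_pos _) (by norm_num)]
    linarith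
  rw [circleMetric, cuspMetric, hx]
  calc _ < ‖deriv f p / f p‖ / 30 * (30 / 34) := by gcongr; exact he.trans_lt he2
    _ = _ := by ring

theorem cuspMetric_lt_circleMetric {f : ℂ → ℂ} {p : ℂ} (h0 : f p ≠ 0) (h1 : f p ≠ 1)
    (h' : deriv f p ≠ 0) (hx : Real.log ‖f p‖ = 0) : cuspMetric f p < circleMetric f p := by
  have hs := exp_logSinh_le h0 h1
  rw [hx] at hs
  have hy : logSinh (f p) ≤ 0 := by rw [← Real.exp_le_one_iff]; simpa using hs
  have hpos : 0 < ‖deriv f p / f p‖ := norm_pos_iff.2 (div_ne_zero h' h0)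
  have he : 1 < Real.exp (-(logSinh (f p)) / 2
      + (Real.exp (logSinh (f p)) + Real.log ‖f p‖ ^ 2) / 100) := by
    rw [Real.one_lt_exp_iff, hx]
    have := Real.exp_pos (logSinh (f p))
    linarith
  rw [circleMetric, cuspMetric, hx]
  calc _ = ‖deriv f p / f p‖ / 30 * 1 := by simp
    _ < _ := by rw [hx] at he; gcongr

/-- The curvature inequality behind `circleMetric`, where `s = |sinh (L / 2)|` and `x = Re L`. -/
theorem circleMetric_curvature_aux {s x : ℝ} (hs : 0 < s) (hs' : s ≤ 7.5) (hx : |x| ≤ 4) :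
    s⁻¹ * Real.exp ((s + x ^ 2) / 50) / 900 ≤ (s * ((1 - s ^ 2) / (4 * s ^ 2)) + 2) / 100 := by
  have hx2 : x ^ 2 ≤ 16 := by rw [← sq_abs]; nlinarith [abs_nonneg x]
  -- The exponent is at most (7.5 + 16)/50 < 1/2, and e < 4.
  have he : Real.exp ((s + x ^ 2) / 50) ≤ 2 := by
    have h1 : Real.exp ((s + x ^ 2) / 50) ≤ Real.exp (1 / 2) := Real.exp_le_exp.2 (by linarith)
    have h2 : Real.exp (1 / 2) * Real.exp (1 / 2) = Real.exp 1 := by rw [← Real.exp_add]; norm_num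
    nlinarith [Real.exp_one_lt_d9, Real.exp_pos (1 / 2)]
  have h3 : s⁻¹ * Real.exp ((s + x ^ 2) / 50) / 900 ≤ s⁻¹ * 2 / 900 := by gcongr
  refine h3.trans ?_
  rw [← sub_nonneg]
  have : (s * ((1 - s ^ 2) / (4 * s ^ 2)) + 2) / 100 - s⁻¹ * 2 / 900
      = s⁻¹ * (9 * (1 - s ^ 2) + 72 * s - 8) / 3600 := by field_simp; ring
  rw [this]
  -- The expression is 1 + 9s(8 − s), which is why s ≤ 7.5 suffices.
  have : 0 ≤ 9 * (1 - s ^ 2) + 72 * s - 8 := by nlinarith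
  positivity

/-- The term −`logSinh`/2 is harmonic; the curvature comes from s = |sinh(L/2)| and x² = (Re L)²,
with Laplacians s |S'|² and 2 |L'|², where Re S = log s. The first is bounded below through
|coth(L/2)|² ≥ (1 − s²)/s². -/
theorem circleMetric_mul_le {f : ℂ → ℂ} {p : ℂ} {r : ℝ} (hf : AnalyticAt ℂ f p) (h0 : f p ≠ 0)
    (h1 : f p ≠ 1) (h' : deriv f p ≠ 0) (hx : |Real.log ‖f p‖| ≤ 4) (hp : ‖p‖ < r)
    (hm : IsLocalMax (fun c => circleMetric f c * (r ^ 2 - ‖c‖ ^ 2)) p) :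
    circleMetric f p * (r ^ 2 - ‖p‖ ^ 2) ≤ 2 * r := by
  obtain ⟨L, hL, hLe, hL'⟩ := hf.exists_log h0
  obtain ⟨M, hM, hMe, -⟩ := (hf.deriv.div hf h0).exists_log (div_ne_zero h' h0)
  obtain ⟨K, hK, hKe, hK'⟩ := (analyticAt_const (v := (1 : ℂ)).sub hf).exists_log
    (sub_ne_zero.2 h1.symm)
  have hS : AnalyticAt ℂ (fun c => K c - L c / 2 - (Real.log 2 : ℂ)) p := by fun_prop
  have hSe : ∀ᶠ c in 𝓝 p, logSinh (f c) = (K c - L c / 2 - (Real.log 2 : ℂ)).re := by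
    filter_upwards [hLe, hKe] with c h2 h3
    have h3' : Real.log ‖1 - f c‖ = (K c).re := h3
    rw [logSinh, h2, h3', Complex.sub_re, Complex.sub_re, Complex.ofReal_re,
      Complex.div_ofNat_re]
  have hS' : deriv (fun c => K c - L c / 2 - (Real.log 2 : ℂ)) p
      = -(deriv f p / f p) * ((1 + f p) / (2 * (1 - f p))) := by
    have h4 : 1 - f p ≠ 0 := sub_ne_zero.2 h1.symm
    have h2 := ((hK.differentiableAt.hasDerivAt).sub
      (hL.differentiableAt.hasDerivAt.div_const 2)).sub_const (Real.log 2 : ℂ)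
    have h3 : deriv (fun c => 1 - f c) p = - deriv f p := by simp
    have h5 : deriv K p = - deriv f p / (1 - f p) := by rw [hK', ← h3]; rfl
    refine h2.deriv.trans ?_
    rw [h5, hL']
    field_simp
    ring
  have hSp := hSe.self_of_nhds
  have hLp := hLe.self_of_nhds
  set S := fun c => K c - L c / 2 - (Real.log 2 : ℂ) with hSdef
  have J := (hM.hasLaplacianAt_re.add ((hS.hasLaplacianAt_re.const_mul (-1 / 2)).add
    ((hS.hasLaplacianAt_re.exp.add hL.hasLaplacianAt_re.sq).const_mul (1 / 100)))).const_add
    (-Real.log 30)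
  refine J.mul_le_two_mul ?_ hp hm ?_
  · filter_upwards [hLe, hMe, hSe, hf.continuousAt.eventually_ne h0,
      hf.deriv.continuousAt.eventually_ne h'] with c h1 h2 h3 h4 h5
    have h6 : 0 < ‖deriv f c / f c‖ := norm_pos_iff.2 (div_ne_zero h5 h4)
    rw [Pi.div_apply] at h2
    rw [circleMetric, ← h1, ← h2]
    simp only [hSdef]
    rw [← h3, Real.exp_add (-Real.log 30), Real.exp_add (Real.log _), Real.exp_log h6, Real.exp_neg,
      Real.exp_log (by norm_num)]
    ring_nf
  · have hs := exp_logSinh_le_of_abs_le h0 h1 hx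
    have key := circleMetric_curvature_aux (Real.exp_pos (logSinh (f p))) hs hx
    have e2 : ‖(starRingEnd ℂ) (deriv L p)‖ ^ 2 = ‖deriv f p / f p‖ ^ 2 := by
      rw [RCLike.norm_conj, hL']
    have e1 : ‖deriv f p / f p‖ ^ 2 *
        ((1 - Real.exp (logSinh (f p)) ^ 2) / (4 * Real.exp (logSinh (f p)) ^ 2))
        ≤ ‖(starRingEnd ℂ) (deriv S p)‖ ^ 2 := by
      rw [RCLike.norm_conj, hS', norm_mul, norm_neg, mul_pow]
      gcongr
      have h6 : Real.exp (logSinh (f p)) ^ 2 * (4 * ‖f p‖) = ‖1 - f p‖ ^ 2 := by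
        have h3 : Real.exp (Real.log ‖f p‖ / 2) * Real.exp (-(Real.log ‖f p‖ / 2)) = 1 := by
          rw [← Real.exp_add]; simp
        have h5 := norm_eq_exp_half_sq h0
        rw [exp_logSinh h1]
        generalize Real.exp (-(Real.log ‖f p‖ / 2)) = G at *
        generalize Real.exp (Real.log ‖f p‖ / 2) = F at *
        rw [h5]
        linear_combination ‖1 - f p‖ ^ 2 * (F * G + 1) * h3
      -- This is |cosh(L/2)|² + |sinh(L/2)|² ≥ 1, multiplied by 4 |f|.
      have h7 : 4 * ‖f p‖ ≤ ‖1 + f p‖ ^ 2 + ‖1 - f p‖ ^ 2 := by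
        rw [← norm_pow, ← norm_pow]
        calc 4 * ‖f p‖ = ‖(1 + f p) ^ 2 - (1 - f p) ^ 2‖ := by
              rw [show (1 + f p) ^ 2 - (1 - f p) ^ 2 = 4 * f p by ring, norm_mul]; norm_num
          _ ≤ _ := norm_sub_le _ _
      have h8 : 0 < ‖f p‖ := by simpa using h0
      have h9 : 0 < ‖1 - f p‖ := by simpa [sub_eq_zero] using h1.symm
      have h10 := (Real.exp_pos (logSinh (f p)))
      have h11 : 0 < (‖(2 : ℂ)‖ * ‖1 - f p‖) ^ 2 := by simp; positivity
      rw [norm_div, norm_mul, div_pow, div_le_div_iff₀ (by positivity) h11, mul_pow]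
      simp only [Complex.norm_ofNat]
      generalize Real.exp (logSinh (f p)) = s at *
      rw [← h6] at h7 ⊢
      nlinarith [mul_pos h10 h10]
    have e3 : circleMetric f p ^ 2 = ‖deriv f p / f p‖ ^ 2 * ((Real.exp (logSinh (f p)))⁻¹ *
        Real.exp ((Real.exp (logSinh (f p)) + Real.log ‖f p‖ ^ 2) / 50) / 900) := by
      rw [circleMetric, mul_pow, ← Real.exp_nat_mul, ← Real.exp_neg]
      rw [mul_div_assoc, ← mul_assoc, mul_comm _ (_ / 900 : ℝ)]
      rw [show ((2 : ℕ) : ℝ) * (-logSinh (f p) / 2 + (Real.exp (logSinh (f p))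
        + Real.log ‖f p‖ ^ 2) / 100) = -logSinh (f p) + (Real.exp (logSinh (f p))
        + Real.log ‖f p‖ ^ 2) / 50 by push_cast; ring, Real.exp_add]
      ring
    rw [e3, e2]
    have hS2 : (S p).re = logSinh (f p) := hSp.symm
    rw [hS2]
    have h10 := (Real.exp_pos (logSinh (f p)))
    generalize ‖(starRingEnd ℂ) (deriv S p)‖ ^ 2 = m at *
    generalize Real.exp (logSinh (f p)) = s at *
    have k1 := mul_le_mul_of_nonneg_left key (sq_nonneg ‖deriv f p / f p‖)
    have k2 := mul_le_mul_of_nonneg_left e1 h10.le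
    refine k1.trans ?_
    linarith

/-! ### Gluing the metrics, and Landau's theorem -/

/-- Both metrics are weighted by r² − |c|². If the maximum of the weighted `cuspMetric` exceeds 2r,
it lies on |f| = 1, where `circleMetric` is larger; the maximum of the latter over |log |f|| ≤ 4
then yields a contradiction. -/
theorem cuspMetric_zero_mul_le {f : ℂ → ℂ} {r : ℝ} (hr : 0 < r)
    (hf : AnalyticOnNhd ℂ f (Metric.closedBall 0 r)) (h0 : ∀ c ∈ Metric.closedBall 0 r, f c ≠ 0)
    (h1 : ∀ c ∈ Metric.closedBall 0 r, f c ≠ 1) : cuspMetric f 0 * r ≤ 2 := by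
  set B := Metric.closedBall (0 : ℂ) r with hB
  have hBc : IsCompact B := isCompact_closedBall 0 r
  have h0B : (0 : ℂ) ∈ B := by simp [hB, hr.le]
  have cf : ContinuousOn f B := hf.continuousOn
  have cf' : ContinuousOn (deriv f) B := hf.deriv.continuousOn
  have cX : ContinuousOn (fun c => Real.log ‖f c‖) B := cf.norm.log fun c hc => by simpa using h0 c hc
  have cY : ContinuousOn (fun c => logSinh (f c)) B :=
    (((continuousOn_const.sub cf).norm.log fun c hc => by
      simpa [sub_eq_zero] using (h1 c hc).symm).sub (cX.div_const 2)).sub continuousOn_const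
  have cQ : ContinuousOn (fun c => ‖deriv f c / f c‖) B := (cf'.div cf h0).norm
  have cN : ContinuousOn (fun c : ℂ => r ^ 2 - ‖c‖ ^ 2) B := by fun_prop
  have c1 : ContinuousOn (fun c => cuspMetric f c * (r ^ 2 - ‖c‖ ^ 2)) B :=
    (cQ.div (cX.abs.add continuousOn_const) fun c _ =>
      (add_pos_of_nonneg_of_pos (abs_nonneg _) (by norm_num)).ne').mul cN
  have c2 : ContinuousOn (fun c => circleMetric f c * (r ^ 2 - ‖c‖ ^ 2)) B :=
    ((cQ.div_const 30).mul (Real.continuous_exp.comp_continuousOn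
      ((cY.neg.div_const 2).add (((Real.continuous_exp.comp_continuousOn cY).add
        (cX.pow 2)).div_const 100)))).mul cN
  have u1n : ∀ c, 0 ≤ cuspMetric f c := fun c => by unfold cuspMetric; positivity
  have u2n : ∀ c, 0 ≤ circleMetric f c := fun c => by unfold circleMetric; positivity
  have pos : ∀ (u : ℂ → ℝ) (c : ℂ), c ∈ B → (0 ≤ u c) → 0 < u c * (r ^ 2 - ‖c‖ ^ 2) →
      ‖c‖ < r ∧ 0 < u c ∧ B ∈ 𝓝 c := by
    intro u c hc hu h
    have hN : 0 < r ^ 2 - ‖c‖ ^ 2 := pos_of_mul_pos_right h hu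
    have hlt : ‖c‖ < r := by nlinarith [norm_nonneg c]
    refine ⟨hlt, pos_of_mul_pos_left h hN.le, ?_⟩
    exact mem_of_superset (Metric.isOpen_ball.mem_nhds (by simpa using hlt))
      Metric.ball_subset_closedBall
  have d1 : ∀ c, 0 < cuspMetric f c → deriv f c ≠ 0 := by
    intro c h e; simp [cuspMetric, e] at h
  have d2 : ∀ c, 0 < circleMetric f c → deriv f c ≠ 0 := by
    intro c h e; simp [circleMetric, e] at h
  obtain ⟨a, haB, ha⟩ := hBc.exists_isMaxOn ⟨0, h0B⟩ c1
  suffices hfin : cuspMetric f a * (r ^ 2 - ‖a‖ ^ 2) ≤ 2 * r by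
    have h2 := (ha h0B).trans hfin
    simp only [norm_zero] at h2
    have h3 : (cuspMetric f 0 * r) * r ≤ 2 * r := by nlinarith
    exact le_of_mul_le_mul_right h3 hr
  by_contra! hcon
  obtain ⟨ha1, ha2, ha3⟩ := pos _ a haB (u1n a) (lt_trans (by positivity) hcon)
  have hax : Real.log ‖f a‖ = 0 := by
    by_contra hx
    exact hcon.not_ge (cuspMetric_mul_le (hf a haB) (h0 a haB) (d1 a ha2) hx ha1
      (ha.isLocalMax ha3))
  set B' := B ∩ {c | |Real.log ‖f c‖| ≤ 4} with hB'
  have hB'c : IsCompact B' := hBc.of_isClosed_subset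
    (cX.abs.preimage_isClosed_of_isClosed hBc.isClosed isClosed_Iic) Set.inter_subset_left
  obtain ⟨b, hb, hbm⟩ := hB'c.exists_isMaxOn ⟨a, haB, by simp [hax]⟩ (c2.mono Set.inter_subset_left)
  have hlt := cuspMetric_lt_circleMetric (h0 a haB) (h1 a haB) (d1 a ha2) hax
  have hab : cuspMetric f a * (r ^ 2 - ‖a‖ ^ 2) < circleMetric f b * (r ^ 2 - ‖b‖ ^ 2) := by
    have hN : 0 < r ^ 2 - ‖a‖ ^ 2 := by nlinarith [norm_nonneg a]
    exact (mul_lt_mul_of_pos_right hlt hN).trans_le (hbm ⟨haB, by simp [hax]⟩)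
  obtain ⟨hb1, hb2, hb3⟩ := pos _ b hb.1 (u2n b) (by linarith [mul_pos hr hr])
  -- On |log |f|| = 4 `circleMetric` is the smaller metric, so its weighted value there stays below
  -- the maximum at `a`, which `b` exceeds.
  have hbx : |Real.log ‖f b‖| < 4 := by
    refine lt_of_le_of_ne hb.2 fun e => ?_
    have h2 := circleMetric_lt_cuspMetric (h0 b hb.1) (h1 b hb.1) (d2 b hb2) e
    have hN : 0 < r ^ 2 - ‖b‖ ^ 2 := by nlinarith [norm_nonneg b]
    have h3 := (mul_lt_mul_of_pos_right h2 hN).trans_le (ha hb.1)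
    linarith
  have hB'n : B' ∈ 𝓝 b := inter_mem hb3 (by
    filter_upwards [(cX.abs.continuousAt hb3).eventually (gt_mem_nhds hbx)] with c hc using hc.le)
  have := circleMetric_mul_le (hf b hb.1) (h0 b hb.1) (h1 b hb.1) (d2 b hb2) hbx.le hb1
    (hbm.isLocalMax hB'n)
  linarith

/-- **Landau's theorem**, with the sharp leading constant: a holomorphic function `f` on the unit
disk omitting the values `0` and `1` satisfies `|f' 0| ≤ |f 0| (2 |log |f 0|| + 60)`. -/
theorem norm_deriv_le_of_omits_zero_one {f : ℂ → ℂ}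
    (hf : AnalyticOnNhd ℂ f (Metric.ball 0 1)) (h0 : ∀ c ∈ Metric.ball (0 : ℂ) 1, f c ≠ 0)
    (h1 : ∀ c ∈ Metric.ball (0 : ℂ) 1, f c ≠ 1) :
    ‖deriv f 0‖ ≤ ‖f 0‖ * (2 * |Real.log ‖f 0‖| + 60) := by
  have key : ∀ r : ℝ, r ∈ Set.Ioo (0 : ℝ) 1 → cuspMetric f 0 * r ≤ 2 := by
    intro r hr
    have hsub : Metric.closedBall (0 : ℂ) r ⊆ Metric.ball 0 1 :=
      Metric.closedBall_subset_ball hr.2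
    exact cuspMetric_zero_mul_le hr.1 (hf.mono hsub) (fun c hc => h0 c (hsub hc))
      fun c hc => h1 c (hsub hc)
  have hlim : cuspMetric f 0 * 1 ≤ 2 := by
    have ht : Tendsto (fun r : ℝ => cuspMetric f 0 * r) (𝓝[<] 1) (𝓝 (cuspMetric f 0 * 1)) :=
      ((continuous_const.mul continuous_id).tendsto 1).mono_left nhdsWithin_le_nhds
    exact le_of_tendsto ht (mem_of_superset (Ioo_mem_nhdsLT zero_lt_one) key)
  rw [mul_one, cuspMetric, norm_div, div_le_iff₀ (by positivity),
    div_le_iff₀ (by simpa using h0 0 (by simp))] at hlim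
  linarith

/-! ### Holomorphic motions and their tangent fields -/

theorem Sphere.HolomorphicAt.analyticAt_coord {f : ℂ → Sphere} {c₀ : ℂ}
    (hf : Sphere.HolomorphicAt f c₀) (hfin : ∀ᶠ c in 𝓝 c₀, f c ≠ OnePoint.infty) :
    AnalyticAt ℂ (fun c => Sphere.coord (f c)) c₀ := by
  obtain ⟨g, hg, h | h⟩ := hf
  · refine hg.congr ?_
    filter_upwards [h] with c hc
    rw [hc]; rfl
  · have key : ∀ᶠ c in 𝓝 c₀, g c ≠ 0 ∧ (g c)⁻¹ = Sphere.coord (f c) := by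
      filter_upwards [h, hfin] with c hc hc'
      obtain ⟨z, hz⟩ := OnePoint.ne_infty_iff_exists.1 hc'
      rw [← hz] at hc ⊢
      have hc2 : (if z = 0 then OnePoint.infty else ((z⁻¹ : ℂ) : Sphere)) = (g c : Sphere) := hc
      by_cases hz0 : z = 0
      · rw [if_pos hz0] at hc2
        exact absurd hc2 (OnePoint.infty_ne_coe _)
      · rw [if_neg hz0] at hc2
        have := OnePoint.coe_injective hc2
        rw [← this]
        exact ⟨inv_ne_zero hz0, by rw [inv_inv]; rfl⟩
    exact (hg.inv key.self_of_nhds.1).congr (key.mono fun c hc => hc.2)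

namespace IsNormalizedHolomorphicMotion

variable {E : Set Sphere} {h : ℂ → Sphere → Sphere}

theorem ne_infty (H : IsNormalizedHolomorphicMotion E h) {z : ℂ} (hz : (z : Sphere) ∈ E) {c : ℂ}
    (hc : c ∈ Metric.ball (0 : ℂ) 1) : h c z ≠ OnePoint.infty := by
  rw [← H.fix_infty c hc]
  exact fun e => OnePoint.coe_ne_infty z (H.injOn c hc hz H.infty_mem e)

theorem coord_injective (H : IsNormalizedHolomorphicMotion E h) {z w : ℂ}
    (hz : (z : Sphere) ∈ E) (hw : (w : Sphere) ∈ E) {c : ℂ} (hc : c ∈ Metric.ball (0 : ℂ) 1)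
    (e : Sphere.coord (h c z) = Sphere.coord (h c w)) : z = w := by
  obtain ⟨a, ha⟩ := OnePoint.ne_infty_iff_exists.1 (H.ne_infty hz hc)
  obtain ⟨b, hb⟩ := OnePoint.ne_infty_iff_exists.1 (H.ne_infty hw hc)
  rw [← ha, ← hb] at e
  have e' : a = b := e
  exact OnePoint.coe_injective (H.injOn c hc hz hw (by rw [← ha, ← hb, e']))

theorem analyticOnNhd_coord (H : IsNormalizedHolomorphicMotion E h) {z : ℂ}
    (hz : (z : Sphere) ∈ E) :
    AnalyticOnNhd ℂ (fun c => Sphere.coord (h c z)) (Metric.ball 0 1) := by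
  intro c hc
  refine (H.holomorphic z hz c hc).analyticAt_coord ?_
  filter_upwards [Metric.isOpen_ball.mem_nhds hc] with c' hc' using H.ne_infty hz hc'

theorem coord_base (H : IsNormalizedHolomorphicMotion E h) {z : ℂ} (hz : (z : Sphere) ∈ E) :
    Sphere.coord (h 0 z) = z := by
  rw [H.base z hz]; rfl

theorem tendsto_deriv (H : IsNormalizedHolomorphicMotion E h) {z : ℂ} (hz : (z : Sphere) ∈ E) :
    Tendsto (fun c : ℂ => (Sphere.coord (h c (z : Sphere)) - z) / c) (𝓝[≠] 0)
      (𝓝 (deriv (fun c => Sphere.coord (h c z)) 0)) := by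
  have hd := (H.analyticOnNhd_coord hz 0 (by simp)).differentiableAt.hasDerivAt
  refine (hasDerivAt_iff_tendsto_slope.1 hd).congr fun c => ?_
  rw [slope_def_field, H.coord_base hz, sub_zero]

theorem isTangentField_deriv (H : IsNormalizedHolomorphicMotion E h) :
    IsTangentField E h fun z => deriv (fun c => Sphere.coord (h c z)) 0 :=
  fun _ hz => H.tendsto_deriv hz

theorem hasDerivAt_coord (H : IsNormalizedHolomorphicMotion E h) {V : ℂ → ℂ}
    (hV : IsTangentField E h V) {z : ℂ} (hz : (z : Sphere) ∈ E) :
    HasDerivAt (fun c => Sphere.coord (h c z)) (V z) 0 := by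
  rw [tendsto_nhds_unique (hV z hz) (H.tendsto_deriv hz)]
  exact (H.analyticOnNhd_coord hz 0 (by simp)).differentiableAt.hasDerivAt

/-- A bound for the derivative at `c = 0` of the ratio `(h z₂ - h z₁) / (h w - h z₁)`. -/
theorem norm_ratio_deriv_le (H : IsNormalizedHolomorphicMotion E h) {V : ℂ → ℂ}
    (hV : IsTangentField E h V) {z₁ z₂ w : ℂ} (h₁ : (z₁ : Sphere) ∈ E) (h₂ : (z₂ : Sphere) ∈ E)
    (hw : (w : Sphere) ∈ E) (h12 : z₂ ≠ z₁) (h1w : w ≠ z₁) :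
    ‖((V z₂ - V z₁) * (w - z₁) - (z₂ - z₁) * (V w - V z₁)) / (w - z₁) ^ 2‖ ≤
      ‖(z₂ - z₁) / (w - z₁)‖ * (2 * |Real.log ‖(z₂ - z₁) / (w - z₁)‖| + 60) := by
  -- For z₂ = w the ratio is the constant 1, a value Landau's theorem excludes, but its derivative
  -- is 0.
  rcases eq_or_ne z₂ w with rfl | h2w
  · rw [mul_comm, sub_self, zero_div, norm_zero]
    positivity
  have hne : ∀ {a b : ℂ}, (a : Sphere) ∈ E → (b : Sphere) ∈ E → a ≠ b →
      ∀ c ∈ Metric.ball (0 : ℂ) 1, Sphere.coord (h c a) - Sphere.coord (h c b) ≠ 0 :=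
    fun ha hb hab c hc e => hab (H.coord_injective ha hb hc (sub_eq_zero.1 e))
  have hd := ((H.hasDerivAt_coord hV h₂).sub (H.hasDerivAt_coord hV h₁)).div
    ((H.hasDerivAt_coord hV hw).sub (H.hasDerivAt_coord hV h₁)) (hne hw h₁ h1w 0 (by simp))
  have hL := norm_deriv_le_of_omits_zero_one
    (((H.analyticOnNhd_coord h₂).sub (H.analyticOnNhd_coord h₁)).div
      ((H.analyticOnNhd_coord hw).sub (H.analyticOnNhd_coord h₁)) (hne hw h₁ h1w))
    (fun c hc => div_ne_zero (hne h₂ h₁ h12 c hc) (hne hw h₁ h1w c hc))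
    (fun c hc e => h2w (H.coord_injective h₂ hw hc (by
      simpa using (div_eq_one_iff_eq (hne hw h₁ h1w c hc)).1 e)))
  replace hL := (congrArg norm hd.deriv).symm.trans_le hL
  simpa only [Pi.sub_apply, Pi.div_apply, H.coord_base h₁, H.coord_base h₂, H.coord_base hw]
    using hL

theorem tangent_eq_zero_of_fixed (H : IsNormalizedHolomorphicMotion E h) {V : ℂ → ℂ}
    (hV : IsTangentField E h V) {w : ℂ} (hw : (w : Sphere) ∈ E)
    (hfix : ∀ c ∈ Metric.ball (0 : ℂ) 1, h c w = w) : V w = 0 := by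
  refine (H.hasDerivAt_coord hV hw).unique
    ((hasDerivAt_const (0 : ℂ) w).congr_of_eventuallyEq ?_)
  filter_upwards [Metric.ball_mem_nhds (0 : ℂ) one_pos] with c hc
  rw [hfix c hc]; rfl

theorem norm_tangent_le (H : IsNormalizedHolomorphicMotion E h) {V : ℂ → ℂ}
    (hV : IsTangentField E h V) {z : ℂ} (hz : (z : Sphere) ∈ E) :
    ‖V z‖ ≤ ‖z‖ * (2 * |Real.log ‖z‖| + 60) := by
  have hV0 := H.tangent_eq_zero_of_fixed hV H.zero_mem H.fix_zero
  have hV1 := H.tangent_eq_zero_of_fixed hV H.one_mem H.fix_one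
  rcases eq_or_ne z 0 with rfl | h0
  · simp [hV0]
  · simpa [hV0, hV1] using H.norm_ratio_deriv_le hV H.zero_mem hz H.one_mem h0 one_ne_zero

end IsNormalizedHolomorphicMotion

/-! ### Elementary bounds and the main estimate -/

theorem mul_two_abs_log_le {x R : ℝ} (hx : 0 ≤ x) (hxR : x ≤ R) :
    x * (2 * |Real.log x| + 60) ≤ 2 * (1 + R ^ 2) + 60 * R := by
  have hR : 0 ≤ R := hx.trans hxR
  have : x * |Real.log x| ≤ 1 + R ^ 2 := by
    rcases le_or_gt x 1 with h1 | h1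
    · rcases hx.eq_or_lt with rfl | h0
      · simp; positivity
      · have := Real.abs_log_mul_self_lt x h0 h1
        rw [abs_mul, abs_of_pos h0, mul_comm] at this
        nlinarith
    · rw [abs_of_pos (Real.log_pos h1)]
      have := Real.log_le_sub_one_of_pos (by linarith : 0 < x)
      nlinarith
  linarith

theorem abs_log_le_of_half_le {x R : ℝ} (hR : 0 ≤ R) (h1 : 1 / 2 ≤ x) (h2 : x ≤ R + 1) :
    |Real.log x| ≤ 1 + R := by
  have hx : 0 < x := by linarith
  rw [abs_le]
  constructor
  · have := Real.one_sub_inv_le_log_of_pos hx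
    have h3 : x⁻¹ ≤ 2 := by rw [inv_le_comm₀ hx (by norm_num)]; linarith
    linarith
  · linarith [Real.log_le_sub_one_of_pos hx]

theorem exists_fixed_far (z : ℂ) : ∃ w : ℂ, (w = 0 ∨ w = 1) ∧ 1 / 2 ≤ ‖w - z‖ := by
  rcases le_total (1 / 2) ‖z‖ with h | h
  · exact ⟨0, Or.inl rfl, by simpa using h⟩
  · refine ⟨1, Or.inr rfl, ?_⟩
    have := norm_sub_norm_le (1 : ℂ) z
    rw [norm_one] at this
    linarith

theorem theorem6p3 (R : ℝ) (hR : 0 < R) :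
    ∃ C : ℝ, ∀ (E : Set Sphere) (h : ℂ → Sphere → Sphere), IsNormalizedHolomorphicMotion E h →
      (∃ V : ℂ → ℂ, IsTangentField E h V) ∧
      ∀ V : ℂ → ℂ, IsTangentField E h V →
        ∀ δ : ℝ, 0 < δ → δ < 1 →
          ∀ z₁ z₂ : ℂ, (z₁ : Sphere) ∈ E → (z₂ : Sphere) ∈ E →
            ‖z₁‖ < R → ‖z₂‖ < R → ‖z₁ - z₂‖ < δ →
              ‖V z₂ - V z₁‖ ≤
                ‖z₂ - z₁‖ * (2 + C / Real.log (1 / δ)) * Real.log (1 / ‖z₂ - z₁‖) := by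
  obtain ⟨K, hKdef⟩ : ∃ K, K = 2 * (1 + R ^ 2) + 60 * R := ⟨_, rfl⟩
  have hK : 0 ≤ K := by rw [hKdef]; positivity
  -- 2(1 + R) pays for log |w − z₁|, 60 is Landau's additive constant, and 2K bounds |V(z₁)| / |w −
  -- z₁|.
  obtain ⟨C, hCdef⟩ : ∃ C, C = 2 * (1 + R) + 60 + 2 * K := ⟨_, rfl⟩
  have hC : 0 ≤ C := by rw [hCdef]; positivity
  refine ⟨C, fun E h H => ⟨⟨_, H.isTangentField_deriv⟩, ?_⟩⟩
  intro V hV δ hδ hδ1 z₁ z₂ h₁ h₂ hz₁ _ hz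
  rcases eq_or_ne z₂ z₁ with rfl | h12
  · simp
  rw [norm_sub_rev] at hz
  obtain ⟨w, hw, hD⟩ := exists_fixed_far z₁
  have hwE : (w : Sphere) ∈ E ∧ V w = 0 ∧ ‖w‖ ≤ 1 := by
    rcases hw with rfl | rfl
    · exact ⟨H.zero_mem, H.tangent_eq_zero_of_fixed hV H.zero_mem H.fix_zero, by simp⟩
    · exact ⟨H.one_mem, H.tangent_eq_zero_of_fixed hV H.one_mem H.fix_one, by simp⟩
  obtain ⟨hwE, hVw, hw1⟩ := hwE
  have hD0 : 0 < ‖w - z₁‖ := by linarith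
  have hDne : w - z₁ ≠ 0 := norm_pos_iff.1 hD0
  have hd0 : 0 < ‖z₂ - z₁‖ := norm_pos_iff.2 (sub_ne_zero.2 h12)
  have hDR : ‖w - z₁‖ ≤ R + 1 := by linarith [norm_sub_le w z₁]
  have hV₁ : ‖V z₁‖ ≤ K :=
    (H.norm_tangent_le hV h₁).trans
      (hKdef ▸ mul_two_abs_log_le (norm_nonneg _) hz₁.le)
  have hratio := H.norm_ratio_deriv_le hV h₁ h₂ hwE h12 (sub_ne_zero.1 hDne)
  rw [hVw, zero_sub, norm_div (z₂ - z₁), Real.log_div hd0.ne' hD0.ne'] at hratio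
  set q := ((V z₂ - V z₁) * (w - z₁) - (z₂ - z₁) * -V z₁) / (w - z₁) ^ 2 with hq
  have hlogD := abs_log_le_of_half_le hR.le hD hDR
  have hlog : Real.log (1 / ‖z₂ - z₁‖) = -Real.log ‖z₂ - z₁‖ := by
    rw [one_div, Real.log_inv]
  have hlogneg : Real.log ‖z₂ - z₁‖ < 0 := Real.log_neg hd0 (hz.trans hδ1)
  -- `q` is the derivative at 0 of the ratio of the motions, solved here for V(z₂) − V(z₁).
  have hsplit : V z₂ - V z₁ = (w - z₁) * q - (z₂ - z₁) * (V z₁ / (w - z₁)) := by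
    rw [hq]; field_simp; ring
  have hA : ‖w - z₁‖ * ‖q‖ ≤ ‖z₂ - z₁‖ * (2 * (-Real.log ‖z₂ - z₁‖ + (1 + R)) + 60) := by
    have h3 : |Real.log ‖z₂ - z₁‖ - Real.log ‖w - z₁‖| ≤ -Real.log ‖z₂ - z₁‖ + (1 + R) := by
      have := abs_sub (Real.log ‖z₂ - z₁‖) (Real.log ‖w - z₁‖)
      rw [abs_of_neg hlogneg] at this
      linarith
    calc ‖w - z₁‖ * ‖q‖ ≤ ‖w - z₁‖ * (‖z₂ - z₁‖ / ‖w - z₁‖ *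
          (2 * (-Real.log ‖z₂ - z₁‖ + (1 + R)) + 60)) := by
          gcongr
          exact hratio.trans (by gcongr)
      _ = _ := by field_simp
  have hB : ‖V z₁ / (w - z₁)‖ ≤ 2 * K := by
    rw [norm_div, div_le_iff₀ hD0]
    nlinarith
  have hmain : ‖V z₂ - V z₁‖ ≤ ‖z₂ - z₁‖ * (2 * Real.log (1 / ‖z₂ - z₁‖) + C) := by
    calc ‖V z₂ - V z₁‖ ≤ ‖w - z₁‖ * ‖q‖ + ‖z₂ - z₁‖ * ‖V z₁ / (w - z₁)‖ := by
          rw [hsplit, ← norm_mul, ← norm_mul]; exact norm_sub_le _ _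
      _ ≤ ‖z₂ - z₁‖ * (2 * (-Real.log ‖z₂ - z₁‖ + (1 + R)) + 60) + ‖z₂ - z₁‖ * (2 * K) := by
          gcongr
      _ = _ := by rw [hlog, hCdef]; ring
  refine hmain.trans ?_
  rw [mul_assoc]
  gcongr
  have hlδ : 0 < Real.log (1 / δ) := Real.log_pos (by rw [lt_div_iff₀ hδ]; linarith)
  have hle : Real.log (1 / δ) ≤ Real.log (1 / ‖z₂ - z₁‖) :=
    Real.log_le_log (by positivity) (by gcongr)
  have : C ≤ C / Real.log (1 / δ) * Real.log (1 / ‖z₂ - z₁‖) := by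
    rw [div_mul_eq_mul_div, le_div_iff₀ hlδ]
    gcongr
  linarith
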